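/- **Corollary (Dual Jacobi–Trudi-type formulas).** Let $\mathbf y=(y_i)_{i\in\mathbb Z}$, $\mathbf z=(z_i)_{i\in\mathbb Z}$ be two families of elements (e.g. variables) of a commutative ring, and write $\mathbf y_{p,q}=(y_p,\dots,y_q)$ ($=\varnothing$ if $p>q$). For $k\ge 0$ put $h_k(\mathbf y_{p,q}/\mathbf z_{s,t})=\sum_{i=0}^k(-1)^{k-i}h_i(\mathbf y_{p,q})\,e_{k-i}(\mathbf z_{s,t})$, and put $h_k=0$ for $k<0$. *Shapes and flags.* An r-shape $(\lambda/\mu,r)$ is a skew shape $\lambda/\mu$ together with an integer $r$; the content of the position $(i,j)$ is $c(i,j)=j-i+r-1+\lambda'_1$. The usual shape $\lambda/\mu$ has $r=1-\lambda'_1$, so $c(i,j)=j-i$. Integer sequences $\mathbf a'=(a'_i)_{i\ge1}$, $\mathbf b'=(b'_i)_{i\ge1}$ are row flags for $\lambda/\mu$ if $a'_i\le a'_{i+1}$ and $b'_i\le b'_{i+1}$ whenever $\mu_i<\lambda_{i+1}$. Their conjugate flags are $a_i=a'_i+c(i,\mu_i+1)$ and $b_i=b'_i+c(i,\lambda_i)$.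 For $m\ge\ell(\lambda)$ the row flagged supersymmetric Schur function of the r-shape is $$\overline{\mathsf S}^{\mathbf a',\mathbf b'}_{\lambda/\mu}(\mathbf y/\mathbf z)=\det\left[h_{\lambda_i-\mu_j-i+j}(\mathbf y_{a'_j,b'_i}/\mathbf z_{a_j,b_i})\right]_{1\le i,j\le m}.$$ For $N\ge 0$ and $c\in\mathbb Z$, let $e^{\mathbf p',\mathbf q'}_{N,c}(\mathbf y/\mathbf z)$ be this function for the one-column r-shape $(1^N,c)$ with flags $\mathbf p',\mathbf q'\in\mathbb Z^N$, computed with $m=N$; so it is $1$ for $N=0$. Put $e_{N,c}=0$ for $N<0$. *Induced flags.* Let $\mathbf a',\mathbf b'$ be row flags for the usual shape $\lambda/\mu$. For $i,j\ge1$ let $N=\lambda'_i-\mu'_j-i+j$ and $c=i-\lambda'_i$. If $N\ge 0$, the induced flags $\mathbf a'^{ij},\mathbf b'^{ij}\in\mathbb Z^{N}$ on $(1^N,c)$ are defined as follows. The cell in row $k$ of $(1^N,c)$, counted from the top, has content $d=c+N-k$. Then $a'^{ij}_k=a'_u$, where $u$ is the row of the leftmost cell of content $d$ in $\lambda/\mu$,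 and $b'^{ij}_k=b'_v$, where $v$ is the row of the rightmost cell of content $d$ in $\lambda/\mu$. If $\lambda/\mu$ has no cell of content $d$, take $u=v=1$. *Statement.* For every skew shape $\lambda/\mu$, all row flags $\mathbf a',\mathbf b'$ for it, and all $m\ge\ell(\lambda)$ and $n\ge\lambda_1$, $$\overline{\mathsf S}^{\mathbf a',\mathbf b'}_{\lambda/\mu}(\mathbf y/\mathbf z)=\det\left[e^{\mathbf a'^{ij},\mathbf b'^{ij}}_{\lambda'_i-\mu'_j-i+j,\;i-\lambda'_i}(\mathbf y/\mathbf z)\right]_{1\le i,j\le n},$$ where the left-hand side is computed by the $m\times m$ determinant above. -/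

import Mathlib

/-- The complete homogeneous symmetric polynomial `h_k` in the variables `x_i`, `i ∈ s`. -/
def completeH {R : Type*} [CommRing R] (s : Finset ℤ) (x : ℤ → R) (k : ℕ) : R :=
  ∑ m ∈ s.sym k, ((m : Multiset ℤ).map x).prod

/-- The elementary symmetric polynomial `e_k` in the variables `x_i`, `i ∈ s`. -/
def elementaryE {R : Type*} [CommRing R] (s : Finset ℤ) (x : ℤ → R) (k : ℕ) : R :=
  ∑ t ∈ s.powersetCard k, ∏ i ∈ t, x i

/-- The complete homogeneous supersymmetric function
`h_k(y_s / z_t) = ∑_{i=0}^k (-1)^(k-i) h_i(y_s) e_{k-i}(z_t)`. It is `0` for `k < 0`. -/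
def superH {R : Type*} [CommRing R] (s t : Finset ℤ) (y z : ℤ → R) (k : ℤ) : R :=
  if 0 ≤ k then
    ∑ i ∈ Finset.range (k.toNat + 1),
      (-1) ^ (k.toNat - i) * completeH s y i * elementaryE t z (k.toNat - i)
  else 0

/-- A skew r-shape `(λ/μ, r)`: a skew shape with a prescribed root content `r`, the content of the
bottom-left cell of `λ`. Rows and columns are indexed from `0`, as in `YoungDiagram`. -/
structure SkewRShape where
  outer : YoungDiagram
  inner : YoungDiagram
  inner_le : inner ≤ outer
  root : ℤ

namespace SkewRShape

/-- The shifted content of position `(i, j)`. The root content is attained at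
`(λ'_1 - 1, 0)` in `0`-based coordinates. -/
def content (S : SkewRShape) (i j : ℤ) : ℤ :=
  j - i + S.root - 1 + (S.outer.colLen 0 : ℤ)

/-- The cells of the diagram `[λ] \ [μ]`. -/
def cells (S : SkewRShape) : Finset (ℕ × ℕ) :=
  S.outer.cells \ S.inner.cells

/-- The usual shape `λ/μ`, whose root content is `1 - λ'_1`. -/
def usual (lam mu : YoungDiagram) (h : mu ≤ lam) : SkewRShape :=
  ⟨lam, mu, h, 1 - (lam.colLen 0 : ℤ)⟩

/-- Row flags for a skew r-shape. Vectors are extended to sequences; the condition constrains only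
the entries belonging to rows of the shape. -/
def IsRowFlags (S : SkewRShape) (a b : ℕ → ℤ) : Prop :=
  ∀ i : ℕ, S.inner.rowLen i < S.outer.rowLen (i + 1) → a i ≤ a (i + 1) ∧ b i ≤ b (i + 1)

/-- The lower flag conjugate to the row flag `a'`: add the content of the leftmost cell of the row,
that is the cell `(i, μ_i)` in `0`-based coordinates. -/
def conjLower (S : SkewRShape) (a : ℕ → ℤ) (i : ℕ) : ℤ :=
  a i + S.content i (S.inner.rowLen i)

/-- The upper flag conjugate to the row flag `b'`: add the content of the rightmost cell of the row,
that is the cell `(i, λ_i - 1)` in `0`-based coordinates. -/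
def conjUpper (S : SkewRShape) (b : ℕ → ℤ) (i : ℕ) : ℤ :=
  b i + S.content i ((S.outer.rowLen i : ℤ) - 1)

/-- The row flagged supersymmetric Schur function, given by the `n × n` determinant
`det [h_{λ_i - μ_j - i + j}(y_{a'_j, b'_i} / z_{a_j, b_i})]`, for `n ≥ ℓ(λ)`. -/
noncomputable def rowFlaggedSchur {R : Type*} [CommRing R] (S : SkewRShape) (n : ℕ) (a b : ℕ → ℤ)
    (y z : ℤ → R) : R :=
  Matrix.det (Matrix.of fun i j : Fin n =>
    superH (Finset.Icc (a j) (b i)) (Finset.Icc (S.conjLower a j) (S.conjUpper b i)) y z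
      ((S.outer.rowLen i : ℤ) - (S.inner.rowLen j : ℤ) - (i : ℤ) + (j : ℤ)))

/-- The rows of the cells of the diagram that have content `c`. -/
def diagonalRows (S : SkewRShape) (c : ℤ) : Finset ℕ :=
  (S.cells.filter fun p => S.content p.1 p.2 = c).image Prod.fst

/-- The row of the leftmost cell of content `c`: on a diagonal it is the cell in the topmost row.
The value is `0` when no cell has content `c`. -/
def leftmostRow (S : SkewRShape) (c : ℤ) : ℕ :=
  (S.diagonalRows c).min.untopD 0

/-- The row of the rightmost cell of content `c`: on a diagonal it is the cell in the lowest row.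
The value is `0` when no cell has content `c`. -/
def rightmostRow (S : SkewRShape) (c : ℤ) : ℕ :=
  (S.diagonalRows c).max.unbotD 0

/-- The lower row flag that a row flag `a` of `S` induces on a ribbon `T`. The up canonical
decomposition of a ribbon consists of its rows; row `k` of `T` (counted from the top, as for all row
flags) receives the flag of `S` at the row of the leftmost cell of `S` that has the same content as
the leftmost cell of row `k` of `T`. -/
def inducedLower (S T : SkewRShape) (a : ℕ → ℤ) (k : ℕ) : ℤ :=
  a (S.leftmostRow (T.content k (T.inner.rowLen k)))

/-- The upper row flag that a row flag `b` of `S` induces on a ribbon `T`: row `k` of `T` receives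
the flag of `S` at the row of the rightmost cell of `S` that has the same content as the rightmost
cell of row `k` of `T`. -/
def inducedUpper (S T : SkewRShape) (b : ℕ → ℤ) (k : ℕ) : ℤ :=
  b (S.rightmostRow (T.content k ((T.outer.rowLen k : ℤ) - 1)))

end SkewRShape

/-- The one-column Young diagram `1^N`. -/
def columnDiagram (N : ℕ) : YoungDiagram where
  cells := Finset.range N ×ˢ {0}
  isLowerSet := by
    rintro ⟨i, j⟩ ⟨i', j'⟩ ⟨h1, h2⟩ h
    simp only [Finset.coe_product, Finset.coe_range, Finset.coe_singleton, Set.mem_prod,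
      Set.mem_Iio, Set.mem_singleton_iff] at h h1 h2 ⊢
    omega

/-- The one-column r-shape `(1^N, c)`. -/
def columnShape (N : ℕ) (c : ℤ) : SkewRShape :=
  ⟨columnDiagram N, ⊥, bot_le, c⟩

/-- The flagged supersymmetric elementary function `e^{p', q'}_{N, c}(y / z)`: the row flagged
supersymmetric Schur function of the r-shape `(1^N, c)`. It is `1` for `N = 0`. -/
noncomputable def flaggedE {R : Type*} [CommRing R] (N : ℕ) (c : ℤ) (p q : ℕ → ℤ) (y z : ℤ → R) : R :=
  (columnShape N c).rowFlaggedSchur N p q y z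

/-- The function `e^{a'^{ij}, b'^{ij}}_{N, c}(y / z)` for the row flags induced by `a', b'` on the
r-shape `(1^N, c)`. For `N < 0` the r-shape is undefined and the function is `0`. -/
noncomputable def inducedFlaggedE {R : Type*} [CommRing R] (S : SkewRShape) (a b : ℕ → ℤ) (N c : ℤ)
    (y z : ℤ → R) : R :=
  if 0 ≤ N then
    flaggedE N.toNat c (S.inducedLower (columnShape N.toNat c) a)
      (S.inducedUpper (columnShape N.toNat c) b) y z
  else 0

/-! Both sides are minors, up to sign, of one unitriangular matrix over the integers and of its
inverse. Let `H s t` be the flagged `h` of the strip of contents `s, …, t - 1` (`stripH`). After the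
irrelevant flags of empty rows are replaced (`rowFlaggedSchur_usual`), the left side is the minor of
`H` with rows `μ_j - j` and columns `λ_i - i` (0-based). A one-column function is a minor of `H` on
adjacent intervals (`flaggedE_induced`), hence by Cramer's rule an entry of the inverse up to sign
(`inverse_eq_shiftedMinor`).

In `[1 - m, n]` the complement of the row labels `λ_i - i` is the set of column labels `j + 1 -
λ'_j`, and likewise for `μ`. Jacobi's complementary minor theorem therefore turns the row minor of
`H` into the column minor of its inverse. The sign of the relabelling (`sign_edgeEquiv`) cancels the
signs of the cofactors. -/

/-! ### Zero blocks and complementary minors -/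

namespace Matrix

/-- Entries above a zero block do not contribute to the determinant: two matrices with the same
zero blocks below the cuts `k` with `P k` have the same determinant as soon as they agree at the
entries that lie above no such cut. -/
theorem det_eq_of_cuts {R : Type*} [CommRing R] {m : ℕ} (P : ℕ → Prop)
    (M M' : Matrix (Fin m) (Fin m) R)
    (hM : ∀ k, P k → ∀ i j : Fin m, k ≤ i → (j : ℕ) < k → M i j = 0)
    (hM' : ∀ k, P k → ∀ i j : Fin m, k ≤ i → (j : ℕ) < k → M' i j = 0)
    (h : ∀ i j : Fin m, (∀ k, P k → (i : ℕ) < k → (j : ℕ) < k) → M i j = M' i j) :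
    M.det = M'.det := by
  rw [det_apply, det_apply]
  refine Finset.sum_congr rfl fun σ _ => ?_
  congr 1
  by_cases hσ : ∀ j : Fin m, ∀ k, P k → (σ j : ℕ) < k → (j : ℕ) < k
  · exact Finset.prod_congr rfl fun j _ => h _ _ (hσ j)
  · push Not at hσ
    obtain ⟨j, k, hk, hj, hkj⟩ := hσ
    -- Pigeonhole: if `σ` kept all indices below `k` below `k`, they would fill those positions and
    -- leave no room for `σ j`. So `σ` also meets the zero block, and both products vanish.
    obtain ⟨j', hj', hkj'⟩ : ∃ j' : Fin m, (j' : ℕ) < k ∧ k ≤ σ j' := by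
      by_contra! hcon
      have himg : (Finset.univ.filter fun x : Fin m => (x : ℕ) < k).image σ =
          Finset.univ.filter fun x : Fin m => (x : ℕ) < k := by
        refine Finset.eq_of_subset_of_card_le ?_ ?_
        · intro x hx
          simp only [Finset.mem_image, Finset.mem_filter, Finset.mem_univ, true_and] at hx ⊢
          obtain ⟨w, hw, rfl⟩ := hx
          exact hcon w hw
        · rw [Finset.card_image_of_injective _ σ.injective]
      have hmem : σ j ∈ (Finset.univ.filter fun x : Fin m => (x : ℕ) < k).image σ := by
        rw [himg]; simpa using hj
      simp only [Finset.mem_image, Finset.mem_filter, Finset.mem_univ, true_and,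
        EmbeddingLike.apply_eq_iff_eq, exists_eq_right] at hmem
      omega
    exact (Finset.prod_eq_zero (f := fun j => M (σ j) j) (Finset.mem_univ j')
      (hM k hk _ _ hkj' hj')).trans (Finset.prod_eq_zero (f := fun j => M' (σ j) j)
        (Finset.mem_univ j') (hM' k hk _ _ hkj' hj')).symm

/-- Jacobi's complementary minor theorem, for the upper left block. -/
theorem det_toBlocks₁₁_of_mul_eq_one {R α β : Type*} [CommRing R] [Fintype α] [Fintype β]
    [DecidableEq α] [DecidableEq β] (K L : Matrix (α ⊕ β) (α ⊕ β) R) (h : K * L = 1) :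
    K.toBlocks₁₁.det = K.det * L.toBlocks₂₂.det := by
  -- Only the second block column of `L` is kept, so both the right factor and the product are block
  -- triangular and their determinants can be read off.
  have h1 : K * fromBlocks 1 L.toBlocks₁₂ 0 L.toBlocks₂₂ =
      fromBlocks K.toBlocks₁₁ 0 K.toBlocks₂₁ 1 := by
    have h' := h
    rw [← fromBlocks_toBlocks K, ← fromBlocks_toBlocks L, fromBlocks_multiply, ← fromBlocks_one,
      fromBlocks_inj] at h'
    conv_lhs => rw [← fromBlocks_toBlocks K]
    rw [fromBlocks_multiply, h'.2.1, h'.2.2.2]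
    simp
  have h2 := congrArg det h1
  rw [det_mul, det_fromBlocks_zero₂₁, det_fromBlocks_zero₁₂] at h2
  simpa using h2.symm

end Matrix

/-! ### Inverse of a unitriangular matrix -/

/-- The minor of `H` with rows `c, …, c + N - 1` and columns `c + 1, …, c + N`, both listed
in decreasing order. -/
noncomputable def shiftedMinor {R : Type*} [CommRing R] (H : ℤ → ℤ → R) (c : ℤ) (N : ℕ) : R :=
  Matrix.det (Matrix.of fun i j : Fin N => H (c + N - 1 - j) (c + N - i))

theorem det_eq_one_of_unitriangular {R : Type*} [CommRing R] {H : ℤ → ℤ → R}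
    (h0 : ∀ s t, t < s → H s t = 0) (h1 : ∀ s, H s s = 1) {ι : Type*} [Fintype ι] [LinearOrder ι] (f : ι → ℤ)
    (hf : StrictMono f) : Matrix.det (Matrix.of fun p q => H (f p) (f q)) = 1 := by
  rw [Matrix.det_of_isUpperTriangular]
  · simp [h1]
  · intro p q hpq
    exact h0 _ _ (hf hpq)

/-- By triangularity the entry at `(p, q)` depends only on the window `[p, q]`, where it is the
corner cofactor of a matrix of determinant one. -/
theorem inverse_eq_shiftedMinor {R : Type*} [CommRing R] {H : ℤ → ℤ → R}
    (h0 : ∀ s t, t < s → H s t = 0) (h1 : ∀ s, H s s = 1) {u v : ℤ} (G : Matrix (Finset.Icc u v) (Finset.Icc u v) R)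
    (hG : (Matrix.of fun p q : Finset.Icc u v => H p q) * G = 1)
    (hG0 : ∀ p q, q < p → G p q = 0) (p q : Finset.Icc u v) (N : ℕ) (hN : (q : ℤ) = p + N) :
    G p q = (-1) ^ N * shiftedMinor H p N := by
  obtain ⟨p, hp⟩ := p
  obtain ⟨q, hq⟩ := q
  simp only at hN ⊢
  subst hN
  rw [Finset.mem_Icc] at hp hq
  let f : Fin (N + 1) → Finset.Icc u v := fun x => ⟨p + x, Finset.mem_Icc.2 (by omega)⟩
  have hfinj : Function.Injective f := fun x y hxy => by
    simp only [f, Subtype.mk.injEq] at hxy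
    omega
  let K : Matrix (Fin (N + 1)) (Fin (N + 1)) R := Matrix.of fun x y => H (p + x) (p + y)
  have hK : K * G.submatrix f f = 1 := by
    ext x y
    have := congrFun (congrFun hG (f x)) (f y)
    rw [Matrix.mul_apply] at this ⊢
    simp only [Matrix.one_apply, hfinj.eq_iff] at this
    rw [Matrix.one_apply, ← this]
    -- Indices outside the window contribute nothing: below it the factor from `H` vanishes, above
    -- it the factor from `G`.
    refine Finset.sum_of_injOn f hfinj.injOn (by simp) ?_ (fun _ _ => rfl)
    intro w _ hw
    rw [Matrix.of_apply]
    by_cases hw1 : (w : ℤ) < p + x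
    · rw [h0 _ _ hw1, zero_mul]
    by_cases hw2 : f y < w
    · rw [hG0 _ _ hw2, mul_zero]
    exfalso
    apply hw
    rw [not_lt, ← Subtype.coe_le_coe] at hw2
    simp only [f] at hw2
    refine ⟨⟨((w : ℤ) - p).toNat, by omega⟩, by simp, Subtype.ext ?_⟩
    simp only [f]
    omega
  have hdet : K.det = 1 :=
    det_eq_one_of_unitriangular h0 h1 (fun x : Fin (N + 1) => p + x) (fun x y hxy => by
      have : (x : ℕ) < y := hxy
      simp only
      omega)
  have hadj : G.submatrix f f = K.adjugate := by
    rw [← Matrix.mul_one K.adjugate, ← hK, ← Matrix.mul_assoc, Matrix.adjugate_mul, hdet, one_smul,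
      Matrix.one_mul]
  have hent := congrFun (congrFun hadj 0) (Fin.last N)
  rw [Matrix.adjugate_fin_succ_eq_det_submatrix, Matrix.submatrix_apply] at hent
  have e1 : f 0 = ⟨p, Finset.mem_Icc.2 hp⟩ := by simp [f]
  have e2 : f (Fin.last N) = ⟨p + N, Finset.mem_Icc.2 hq⟩ := by simp [f]
  rw [e1, e2] at hent
  -- The cofactor omits the last row and the first column. Transposing and reversing both orders
  -- gives the decreasing lists of `shiftedMinor`.
  rw [hent, shiftedMinor, ← Matrix.det_transpose, ← Matrix.det_submatrix_equiv_self Fin.revPerm]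
  rw [Fin.val_last, Fin.val_zero, Nat.add_zero]
  congr 2
  ext i j
  simp only [K, Matrix.submatrix_apply, Matrix.transpose_apply, Matrix.of_apply, Fin.revPerm_apply,
    Fin.succAbove_last, Fin.zero_succAbove, Fin.val_castSucc, Fin.val_succ, Fin.val_rev]
  congr 1 <;> omega

/-! ### Edge labels of Young diagrams and their sign -/

namespace YoungDiagram

theorem lt_rowLen_iff_lt_colLen (μ : YoungDiagram) (i j : ℕ) :
    j < μ.rowLen i ↔ i < μ.colLen j := by
  rw [← mem_iff_lt_rowLen, mem_iff_lt_colLen]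

/-- The edge sequence of a Young diagram: vertical boundary edges come from the rows and
horizontal ones from the columns. -/
def edge (μ : YoungDiagram) (m n : ℕ) : Fin m ⊕ Fin n → ℤ :=
  Sum.elim (fun i => (μ.rowLen i : ℤ) - i) (fun j => (j : ℤ) + 1 - μ.colLen j)

theorem edge_mem_Icc (μ : YoungDiagram) {m n : ℕ} (hm : μ.colLen 0 ≤ m) (hn : μ.rowLen 0 ≤ n)
    (x : Fin m ⊕ Fin n) : μ.edge m n x ∈ Finset.Icc (1 - m : ℤ) n := by
  rcases x with i | j
  · have := μ.rowLen_anti 0 i (Nat.zero_le _)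
    simp only [edge, Sum.elim_inl, Finset.mem_Icc]
    omega
  · have := μ.colLen_anti 0 j (Nat.zero_le _)
    simp only [edge, Sum.elim_inr, Finset.mem_Icc]
    omega

theorem edge_injective (μ : YoungDiagram) (m n : ℕ) : Function.Injective (μ.edge m n) := by
  have hr : ∀ i j : ℕ, i < j → (μ.rowLen j : ℤ) - j < μ.rowLen i - i := fun i j hij => by
    have := μ.rowLen_anti i j hij.le
    omega
  have hc : ∀ i j : ℕ, i < j → (i : ℤ) + 1 - μ.colLen i < j + 1 - μ.colLen j := fun i j hij => by
    have := μ.colLen_anti i j hij.le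
    omega
  -- Equality would need `μ_i + μ'_j = i + j + 1`, but this sum is at least `i + j + 2` if `(i, j)`
  -- is a cell and at most `i + j` if not.
  have hrc : ∀ i j : ℕ, (μ.rowLen i : ℤ) - i ≠ j + 1 - μ.colLen j := fun i j hij => by
    have := μ.lt_rowLen_iff_lt_colLen i j
    omega
  rintro (i | i) (j | j) hij <;> simp only [edge, Sum.elim_inl, Sum.elim_inr] at hij
  · rcases lt_trichotomy (i : ℕ) j with h | h | h
    · have := hr _ _ h; omega
    · rw [Fin.ext h]
    · have := hr _ _ h; omega
  · exact absurd hij (hrc _ _)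
  · exact absurd hij.symm (hrc _ _)
  · rcases lt_trichotomy (i : ℕ) j with h | h | h
    · have := hc _ _ h; omega
    · rw [Fin.ext h]
    · have := hc _ _ h; omega

/-- The edges of a Young diagram contained in the `m × n` rectangle are labelled bijectively by
the integers in `[1 - m, n]`. -/
noncomputable def edgeEquiv (μ : YoungDiagram) {m n : ℕ} (hm : μ.colLen 0 ≤ m)
    (hn : μ.rowLen 0 ≤ n) : Fin m ⊕ Fin n ≃ Finset.Icc (1 - m : ℤ) n :=
  Equiv.ofBijective (fun x => ⟨μ.edge m n x, μ.edge_mem_Icc hm hn x⟩) <| by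
    rw [Fintype.bijective_iff_injective_and_card]
    refine ⟨fun x y h => μ.edge_injective m n (congrArg Subtype.val h), ?_⟩
    rw [Fintype.card_coe, Int.card_Icc, Fintype.card_sum, Fintype.card_fin, Fintype.card_fin]
    omega

@[simp]
theorem coe_edgeEquiv (μ : YoungDiagram) {m n : ℕ} (hm : μ.colLen 0 ≤ m) (hn : μ.rowLen 0 ≤ n)
    (x : Fin m ⊕ Fin n) : (μ.edgeEquiv hm hn x : ℤ) = μ.edge m n x := rfl

theorem rowLen_mono {μ ν : YoungDiagram} (h : μ ≤ ν) (i : ℕ) : μ.rowLen i ≤ ν.rowLen i := by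
  by_contra! hlt
  exact lt_irrefl _ (mem_iff_lt_rowLen.1 (h (mem_iff_lt_rowLen.2 hlt)))

theorem colLen_mono {μ ν : YoungDiagram} (h : μ ≤ ν) (j : ℕ) : μ.colLen j ≤ ν.colLen j := by
  by_contra! hlt
  exact lt_irrefl _ (mem_iff_lt_colLen.1 (h (mem_iff_lt_colLen.2 hlt)))

/-- If `μ < lam`, then some corner of `lam` outside `μ` can be removed. -/
theorem exists_remove_corner {μ lam : YoungDiagram} (h : μ < lam) :
    ∃ (ν : YoungDiagram) (r s : ℕ), μ ≤ ν ∧ ν < lam ∧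
      lam.rowLen r = s + 1 ∧ lam.colLen s = r + 1 ∧ ν.rowLen r = s ∧ ν.colLen s = r ∧
      (∀ i, i ≠ r → ν.rowLen i = lam.rowLen i) ∧ (∀ j, j ≠ s → ν.colLen j = lam.colLen j) := by
  have hne : (lam.cells \ μ.cells).Nonempty :=
    Finset.sdiff_nonempty.2 (cells_ssubset_iff.2 h).2
  -- A cell of `lam` weakly southeast of a cell outside `μ` is also outside `μ`, so a cell
  -- maximizing `i + j` there is a corner of `lam`.
  obtain ⟨⟨r, s⟩, hrs, hmax⟩ := Finset.exists_max_image _ (fun x : ℕ × ℕ => x.1 + x.2) hne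
  rw [Finset.mem_sdiff, mem_cells, mem_cells] at hrs
  have hcorner : ∀ i j, r ≤ i → s ≤ j → (i, j) ∈ lam → i = r ∧ j = s := by
    intro i j hi hj hij
    have := hmax (i, j) (Finset.mem_sdiff.2 ⟨hij, fun hμ => hrs.2 (μ.up_left_mem hi hj hμ)⟩)
    simp only at this
    omega
  let ν : YoungDiagram := ⟨lam.cells.erase (r, s), by
    rintro ⟨i, j⟩ ⟨i', j'⟩ hle hij
    simp only [Finset.coe_erase, Set.mem_sdiff, Finset.mem_coe, mem_cells,
      Set.mem_singleton_iff, Prod.mk.injEq] at hij ⊢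
    refine ⟨lam.up_left_mem hle.1 hle.2 hij.1, ?_⟩
    rintro ⟨rfl, rfl⟩
    exact hij.2 (hcorner i j hle.1 hle.2 hij.1)⟩
  have hν : ∀ i j, (i, j) ∈ ν ↔ (i, j) ∈ lam ∧ ¬(i = r ∧ j = s) := by
    intro i j
    rw [← mem_cells, Finset.mem_erase, mem_cells, and_comm, Ne, Prod.mk.injEq]
  have hrow : ∀ i j, j < ν.rowLen i ↔ j < lam.rowLen i ∧ ¬(i = r ∧ j = s) := by
    simpa only [mem_iff_lt_rowLen] using hν
  have hcol : ∀ i j, i < ν.colLen j ↔ i < lam.colLen j ∧ ¬(i = r ∧ j = s) := by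
    simpa only [mem_iff_lt_colLen] using hν
  have h1 : lam.rowLen r = s + 1 := by
    have h2 := mem_iff_lt_rowLen.1 hrs.1
    have h3 : ¬ s + 1 < lam.rowLen r := fun h4 => by
      have := hcorner r (s + 1) le_rfl (Nat.le_succ s) (mem_iff_lt_rowLen.2 h4)
      omega
    omega
  have h2 : lam.colLen s = r + 1 := by
    have h2 := mem_iff_lt_colLen.1 hrs.1
    have h3 : ¬ r + 1 < lam.colLen s := fun h4 => by
      have := hcorner (r + 1) s (Nat.le_succ r) le_rfl (mem_iff_lt_colLen.2 h4)
      omega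
    omega
  refine ⟨ν, r, s, ?_, cells_ssubset_iff.1 (Finset.erase_ssubset hrs.1), h1, h2, ?_, ?_, ?_, ?_⟩
  · rintro ⟨i, j⟩ hij
    refine (hν i j).2 ⟨h.le hij, ?_⟩
    rintro ⟨rfl, rfl⟩
    exact hrs.2 hij
  · exact eq_of_forall_lt_iff fun j => by rw [hrow, h1]; omega
  · exact eq_of_forall_lt_iff fun i => by rw [hcol, h2]; omega
  · exact fun i hi => eq_of_forall_lt_iff fun j => by rw [hrow]; tauto
  · exact fun j hj => eq_of_forall_lt_iff fun i => by rw [hcol]; tauto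

/-- Removing a corner `(r, s)` swaps the labels of row `r` and column `s` and lowers one column
length by one, so both sides change sign. Induction reduces to `lam = μ`. -/
theorem sign_edgeEquiv {μ lam : YoungDiagram} (h : μ ≤ lam) {m n : ℕ}
    (hμm : μ.colLen 0 ≤ m) (hμn : μ.rowLen 0 ≤ n) (hm : lam.colLen 0 ≤ m) (hn : lam.rowLen 0 ≤ n) :
    Equiv.Perm.sign ((lam.edgeEquiv hm hn).trans (μ.edgeEquiv hμm hμn).symm) =
      ∏ j : Fin n, (-1) ^ (lam.colLen j + μ.colLen j) := by
  induction hcard : lam.cells.card using Nat.strong_induction_on generalizing lam with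
  | _ N ih =>
  rcases h.eq_or_lt with rfl | hlt
  · rw [Equiv.self_trans_symm, Equiv.Perm.sign_refl, Finset.prod_eq_one]
    exact fun j _ => Even.neg_one_pow ⟨_, rfl⟩
  obtain ⟨ν, r, s, hμν, hν, h1, h2, h3, h4, h5, h6⟩ := exists_remove_corner hlt
  have hνm := (colLen_mono hν.le 0).trans hm
  have hνn := (rowLen_mono hν.le 0).trans hn
  have hr : r < m := by have := lam.colLen_anti 0 s (Nat.zero_le _); omega
  have hs : s < n := by have := lam.rowLen_anti 0 r (Nat.zero_le _); omega
  have hswap : lam.edgeEquiv hm hn =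
      (Equiv.swap (Sum.inl ⟨r, hr⟩) (Sum.inr ⟨s, hs⟩)).trans (ν.edgeEquiv hνm hνn) := by
    ext x
    rw [Equiv.trans_apply, coe_edgeEquiv, coe_edgeEquiv]
    rcases x with i | j
    · by_cases hi : (i : ℕ) = r
      · obtain rfl : i = ⟨r, hr⟩ := Fin.ext hi
        rw [Equiv.swap_apply_left]
        simp only [edge, Sum.elim_inl, Sum.elim_inr, h1, h4]
        push_cast
        ring
      · rw [Equiv.swap_apply_of_ne_of_ne (fun h => hi (by rw [Sum.inl.inj h])) Sum.inl_ne_inr]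
        simp only [edge, Sum.elim_inl, h5 _ hi]
    · by_cases hj : (j : ℕ) = s
      · obtain rfl : j = ⟨s, hs⟩ := Fin.ext hj
        rw [Equiv.swap_apply_right]
        simp only [edge, Sum.elim_inl, Sum.elim_inr, h2, h3]
        push_cast
        ring
      · rw [Equiv.swap_apply_of_ne_of_ne Sum.inr_ne_inl (fun h => hj (by rw [Sum.inr.inj h]))]
        simp only [edge, Sum.elim_inr, h6 _ hj]
  have hlt' := Finset.card_lt_card (cells_ssubset_iff.2 hν)
  have hrec := ih _ (hcard ▸ hlt') hμν hνm hνn rfl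
  rw [hswap, Equiv.trans_assoc, Equiv.Perm.sign_trans, hrec, Equiv.Perm.sign_swap Sum.inl_ne_inr,
    ← Finset.prod_erase_mul _ _ (Finset.mem_univ (⟨s, hs⟩ : Fin n)),
    ← Finset.prod_erase_mul _ (fun j : Fin n => (-1 : ℤˣ) ^ (lam.colLen j + μ.colLen j))
      (Finset.mem_univ (⟨s, hs⟩ : Fin n))]
  have hprod : ∏ j ∈ Finset.univ.erase (⟨s, hs⟩ : Fin n), (-1 : ℤˣ) ^ (ν.colLen j + μ.colLen j) =
      ∏ j ∈ Finset.univ.erase (⟨s, hs⟩ : Fin n), (-1 : ℤˣ) ^ (lam.colLen j + μ.colLen j) := by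
    refine Finset.prod_congr rfl fun j hj => ?_
    rw [h6 _ fun h => (Finset.mem_erase.1 hj).1 (Fin.ext h)]
  rw [hprod, h2, h4, add_right_comm, pow_succ]
  simp

end YoungDiagram

/-! ### Supersymmetric functions and column shapes -/

theorem superH_zero {R : Type*} [CommRing R] (s t : Finset ℤ) (y z : ℤ → R) :
    superH s t y z 0 = 1 := by
  simp only [superH, completeH, elementaryE, le_refl, if_true, Int.toNat_zero, zero_add,
    Finset.range_one, Finset.sum_singleton, Nat.sub_self, pow_zero, Finset.sym_zero,
    Finset.powersetCard_zero, Finset.prod_empty, one_mul, mul_one]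
  exact Multiset.prod_zero

theorem superH_of_neg {R : Type*} [CommRing R] (s t : Finset ℤ) (y z : ℤ → R) {k : ℤ}
    (hk : k < 0) : superH s t y z k = 0 :=
  if_neg (not_le.2 hk)

theorem columnDiagram_colLen_zero (N : ℕ) : (columnDiagram N).colLen 0 = N :=
  eq_of_forall_lt_iff fun i => by
    rw [← YoungDiagram.mem_iff_lt_colLen, ← YoungDiagram.mem_cells]
    simp [columnDiagram]

theorem columnDiagram_rowLen {N k : ℕ} (hk : k < N) : (columnDiagram N).rowLen k = 1 :=
  eq_of_forall_lt_iff fun i => by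
    rw [← YoungDiagram.mem_iff_lt_rowLen, ← YoungDiagram.mem_cells]
    simp [columnDiagram, hk, eq_comm]

theorem YoungDiagram.bot_rowLen (i : ℕ) : (⊥ : YoungDiagram).rowLen i = 0 :=
  eq_of_forall_lt_iff fun j => by
    rw [← YoungDiagram.mem_iff_lt_rowLen]
    simp

/-! ### Strip functions and flags -/

namespace SkewRShape

theorem content_usual (lam mu : YoungDiagram) (h : mu ≤ lam) (i j : ℤ) :
    (usual lam mu h).content i j = j - i := by
  simp only [content, usual]
  ring

theorem content_columnShape (N : ℕ) (c i j : ℤ) :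
    (columnShape N c).content i j = j - i + c - 1 + N := by
  simp only [content, columnShape, columnDiagram_colLen_zero]

theorem mem_diagonalRows_usual (lam mu : YoungDiagram) (h : mu ≤ lam) (c : ℤ) (i : ℕ) :
    i ∈ (usual lam mu h).diagonalRows c ↔
      ∃ j : ℕ, mu.rowLen i ≤ j ∧ j < lam.rowLen i ∧ (j : ℤ) - i = c := by
  simp only [diagonalRows, cells, Finset.mem_image, Finset.mem_filter, Finset.mem_sdiff,
    content_usual, YoungDiagram.mem_cells]
  constructor
  · rintro ⟨⟨i, j⟩, ⟨⟨h1, h2⟩, h3⟩, rfl⟩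
    exact ⟨j, not_lt.1 (mt YoungDiagram.mem_iff_lt_rowLen.2 h2),
      YoungDiagram.mem_iff_lt_rowLen.1 h1, h3⟩
  · rintro ⟨j, h1, h2, h3⟩
    exact ⟨(i, j), ⟨⟨YoungDiagram.mem_iff_lt_rowLen.2 h2,
      mt YoungDiagram.mem_iff_lt_rowLen.1 (not_lt.2 h1)⟩, h3⟩, rfl⟩

/-- A higher position on the diagonal of `(i, μ_i)` has column less than `μ_i`, so it lies in `μ`.
-/
theorem leftmostRow_usual (lam mu : YoungDiagram) (h : mu ≤ lam) (i : ℕ)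
    (hi : mu.rowLen i < lam.rowLen i) :
    (usual lam mu h).leftmostRow ((mu.rowLen i : ℤ) - i) = i := by
  have hmin : ((usual lam mu h).diagonalRows ((mu.rowLen i : ℤ) - i)).min = (i : WithTop ℕ) := by
    have hmem := (mem_diagonalRows_usual lam mu h _ i).2 ⟨mu.rowLen i, le_rfl, hi, rfl⟩
    refine le_antisymm (Finset.min_le hmem) (Finset.le_min fun k hk => ?_)
    · rw [mem_diagonalRows_usual] at hk
      obtain ⟨j, h1, h2, h3⟩ := hk
      refine (WithTop.coe_le_coe (a := k) (b := i)).2 (not_lt.1 fun hlt => ?_)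
      have := mu.rowLen_anti k i hlt.le
      omega
  rw [leftmostRow, hmin]
  rfl

theorem rightmostRow_usual (lam mu : YoungDiagram) (h : mu ≤ lam) (i : ℕ)
    (hi : mu.rowLen i < lam.rowLen i) :
    (usual lam mu h).rightmostRow ((lam.rowLen i : ℤ) - i - 1) = i := by
  have hmax : ((usual lam mu h).diagonalRows ((lam.rowLen i : ℤ) - i - 1)).max =
      (i : WithBot ℕ) := by
    have hmem := (mem_diagonalRows_usual lam mu h ((lam.rowLen i : ℤ) - i - 1) i).2
      ⟨lam.rowLen i - 1, by omega, by omega, by omega⟩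
    refine le_antisymm (Finset.max_le fun k hk => ?_) (Finset.le_max hmem)
    · rw [mem_diagonalRows_usual] at hk
      obtain ⟨j, h1, h2, h3⟩ := hk
      refine (WithBot.coe_le_coe (a := k) (b := i)).2 (not_lt.1 fun hlt => ?_)
      have := lam.rowLen_anti i k hlt.le
      omega
  rw [rightmostRow, hmax]
  rfl

/-- The function `h` of the strip of contents `s, …, t - 1`, whose flags are those of `S` at the
leftmost cell of content `s` and at the rightmost cell of content `t - 1`. -/
noncomputable def stripH {R : Type*} [CommRing R] (S : SkewRShape) (a b : ℕ → ℤ) (y z : ℤ → R)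
    (s t : ℤ) : R :=
  superH (Finset.Icc (a (S.leftmostRow s)) (b (S.rightmostRow (t - 1))))
    (Finset.Icc (a (S.leftmostRow s) + s) (b (S.rightmostRow (t - 1)) + (t - 1))) y z (t - s)

theorem stripH_self {R : Type*} [CommRing R] (S : SkewRShape) (a b : ℕ → ℤ) (y z : ℤ → R)
    (s : ℤ) : S.stripH a b y z s s = 1 := by
  rw [stripH, sub_self, superH_zero]

theorem stripH_of_lt {R : Type*} [CommRing R] (S : SkewRShape) (a b : ℕ → ℤ) (y z : ℤ → R)
    (s t : ℤ) (h : t < s) : S.stripH a b y z s t = 0 :=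
  superH_of_neg _ _ _ _ (sub_neg.2 h)

/-- Each row of the column is a single cell, so the lower flag of row `j` and the upper flag of row
`i` are those at the two ends of the strip from the content of row `j` to that of row `i`. -/
theorem flaggedE_induced {R : Type*} [CommRing R] (S : SkewRShape) (a b : ℕ → ℤ) (N : ℕ) (c : ℤ)
    (y z : ℤ → R) :
    flaggedE N c (S.inducedLower (columnShape N c) a) (S.inducedUpper (columnShape N c) b) y z =
      shiftedMinor (S.stripH a b y z) c N := by
  rw [flaggedE, rowFlaggedSchur, shiftedMinor]
  congr 2
  ext i j
  have hi : (columnShape N c).outer.rowLen i = 1 := columnDiagram_rowLen i.2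
  have hj : (columnShape N c).inner.rowLen j = 0 := YoungDiagram.bot_rowLen j
  simp only [conjLower, conjUpper, inducedLower, inducedUpper, content_columnShape, hi, hj, stripH]
  have e1 : ((0 : ℕ) : ℤ) - (j : ℕ) + c - 1 + N = c + N - 1 - (j : ℕ) := by push_cast; ring
  have e2 : ((1 : ℕ) : ℤ) - 1 - (i : ℕ) + c - 1 + N = c + N - (i : ℕ) - 1 := by push_cast; ring
  have e3 : ((1 : ℕ) : ℤ) - (0 : ℕ) - (i : ℕ) + (j : ℕ) =
      c + N - (i : ℕ) - (c + N - 1 - (j : ℕ)) := by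
    push_cast; ring
  rw [e1, e2, e3]

/-- The flags of the empty rows do not matter, so that the row flagged Schur function is a minor of
the matrix of strip functions. -/
theorem rowFlaggedSchur_usual {R : Type*} [CommRing R] (lam mu : YoungDiagram) (h : mu ≤ lam)
    (m : ℕ) (a b : ℕ → ℤ) (y z : ℤ → R) :
    (usual lam mu h).rowFlaggedSchur m a b y z =
      Matrix.det (Matrix.of fun i j : Fin m =>
        (usual lam mu h).stripH a b y z ((mu.rowLen j : ℤ) - j) ((lam.rowLen i : ℤ) - i)) := by
  -- An empty row `l` gives cuts before and after it; entries below and to the left of either cut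
  -- have negative degree.
  have hcut : ∀ k, (∃ l, mu.rowLen l = lam.rowLen l ∧ (k = l ∨ k = l + 1)) → ∀ i j : Fin m,
      k ≤ i → (j : ℕ) < k → (lam.rowLen i : ℤ) - i < mu.rowLen j - j := by
    rintro k ⟨l, hl, hk⟩ i j hi hj
    have h1 := lam.rowLen_anti l i (by omega)
    have h2 := mu.rowLen_anti j l (by omega)
    omega
  refine Matrix.det_eq_of_cuts (fun k => ∃ l, mu.rowLen l = lam.rowLen l ∧ (k = l ∨ k = l + 1))
    _ _ ?_ ?_ ?_
  · intro k hk i j hi hj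
    have := hcut k hk i j hi hj
    exact superH_of_neg _ _ _ _ (by simp only [usual]; omega)
  · intro k hk i j hi hj
    exact stripH_of_lt _ _ _ _ _ _ _ (hcut k hk i j hi hj)
  · intro i j hij
    simp only [Matrix.of_apply]
    have e : ((usual lam mu h).outer.rowLen i : ℤ) - ((usual lam mu h).inner.rowLen j : ℤ) - (i : ℕ)
        + (j : ℕ) = ((lam.rowLen i : ℤ) - (i : ℕ)) - (mu.rowLen j - (j : ℕ)) := by
      simp only [usual]; ring
    rw [e]
    rcases lt_trichotomy ((lam.rowLen i : ℤ) - (i : ℕ)) (mu.rowLen j - (j : ℕ)) with hlt | heq | hgt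
    · rw [stripH_of_lt _ _ _ _ _ _ _ hlt, superH_of_neg _ _ _ _ (sub_neg.2 hlt)]
    · rw [heq, stripH_self, sub_self, superH_zero]
    -- Only entries of positive degree remain. If row `i` were empty, the cut `i + 1` would force `j
    -- ≤ i`; if row `j` were, the cut `j` would force the same. Either way the degree would be at
    -- most zero.
    have hi : mu.rowLen i < lam.rowLen i := by
      refine lt_of_le_of_ne (YoungDiagram.rowLen_mono h i) fun heq => ?_
      have h1 := hij (i + 1) ⟨i, heq, Or.inr rfl⟩ (Nat.lt_succ_self _)
      have h3 := mu.rowLen_anti j i (by omega)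
      omega
    have hj : mu.rowLen j < lam.rowLen j := by
      refine lt_of_le_of_ne (YoungDiagram.rowLen_mono h j) fun heq => ?_
      have h1 := mt (hij j ⟨j, heq, Or.inl rfl⟩) (lt_irrefl _)
      have h3 := lam.rowLen_anti j i (by omega)
      omega
    rw [stripH, leftmostRow_usual _ _ _ _ hj, rightmostRow_usual _ _ _ _ hi, conjLower, conjUpper,
      content_usual, content_usual]
    simp only [usual]
    rw [sub_right_comm (lam.rowLen i : ℤ)]

end SkewRShape

/-! ### Complementary minors along a skew shape -/

theorem Matrix.exists_upperTriangular_inverse {R ι : Type*} [CommRing R] [Fintype ι]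
    [LinearOrder ι] (K : Matrix ι ι R) (hdet : K.det = 1) (hK : ∀ p q, q < p → K p q = 0) :
    ∃ G : Matrix ι ι R, K * G = 1 ∧ ∀ p q, q < p → G p q = 0 := by
  have hunit : IsUnit K.det := hdet ▸ isUnit_one
  have hinv : Invertible K := K.invertibleOfIsUnitDet hunit
  refine ⟨K⁻¹, K.mul_nonsing_inv hunit, fun p q hpq => ?_⟩
  exact blockTriangular_inv_of_blockTriangular (b := id) (fun p q hpq => hK p q hpq) hpq

/-- The determinants of a unitriangular matrix `H` along the rows and of its shifted minors along
the columns of a skew shape agree. -/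
theorem det_rows_eq_det_shiftedMinor {R : Type*} [CommRing R] {H : ℤ → ℤ → R}
    (h0 : ∀ s t, t < s → H s t = 0) (h1 : ∀ s, H s s = 1) (E : ℤ → ℤ → R)
    (hE : ∀ c (N : ℕ), E c (c + N) = shiftedMinor H c N) (hE0 : ∀ c d, d < c → E c d = 0)
    {lam mu : YoungDiagram} (h : mu ≤ lam)
    {m n : ℕ} (hm : lam.colLen 0 ≤ m) (hn : lam.rowLen 0 ≤ n) :
    Matrix.det (Matrix.of fun i j : Fin m =>
        H ((mu.rowLen j : ℤ) - j) ((lam.rowLen i : ℤ) - i)) =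
      Matrix.det (Matrix.of fun i j : Fin n =>
        E ((i : ℤ) + 1 - lam.colLen i) ((j : ℤ) + 1 - mu.colLen j)) := by
  have hμm := (YoungDiagram.colLen_mono h 0).trans hm
  have hμn := (YoungDiagram.rowLen_mono h 0).trans hn
  obtain ⟨e, he⟩ : ∃ e, e = lam.edgeEquiv hm hn := ⟨_, rfl⟩
  obtain ⟨f, hf⟩ : ∃ f, f = mu.edgeEquiv hμm hμn := ⟨_, rfl⟩
  have her : ∀ i : Fin m, (e (Sum.inl i) : ℤ) = lam.rowLen i - i := fun i => by rw [he]; rfl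
  have hec : ∀ i : Fin n, (e (Sum.inr i) : ℤ) = i + 1 - lam.colLen i := fun i => by rw [he]; rfl
  have hfr : ∀ i : Fin m, (f (Sum.inl i) : ℤ) = mu.rowLen i - i := fun i => by rw [hf]; rfl
  have hfc : ∀ i : Fin n, (f (Sum.inr i) : ℤ) = i + 1 - mu.colLen i := fun i => by rw [hf]; rfl
  let K : Matrix (Finset.Icc (1 - m : ℤ) n) (Finset.Icc (1 - m : ℤ) n) R :=
    Matrix.of fun p q => H p q
  have hdet : K.det = 1 := det_eq_one_of_unitriangular h0 h1 _ (Subtype.strictMono_coe _)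
  obtain ⟨G, hinv, htri⟩ := Matrix.exists_upperTriangular_inverse K hdet
    fun p q hpq => h0 _ _ hpq
  -- The cofactor sign splits into a row sign and a column sign, because the difference of the two
  -- labels has the parity of `λ'_i + i + μ'_j + j`.
  have hG : ∀ i j : Fin n, G (e (Sum.inr i)) (f (Sum.inr j)) =
      (-1) ^ (lam.colLen i + i : ℕ) * ((-1) ^ (mu.colLen j + j : ℕ) *
        E ((i : ℤ) + 1 - lam.colLen i) ((j : ℤ) + 1 - mu.colLen j)) := by
    intro i j
    have hi := hec i
    have hj := hfc j
    rcases lt_or_ge (f (Sum.inr j)) (e (Sum.inr i)) with hlt | hle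
    · rw [htri _ _ hlt]
      rw [← Subtype.coe_lt_coe, hi, hj] at hlt
      rw [hE0 _ _ hlt, mul_zero, mul_zero]
    · rw [← Subtype.coe_le_coe, hi, hj] at hle
      obtain ⟨N, hN⟩ := Int.le.dest hle
      rw [inverse_eq_shiftedMinor h0 h1 _ hinv htri _ _ N (by rw [hi, hj, hN]), ← hN, hE, hi,
        ← mul_assoc, ← pow_add]
      congr 1
      have hsum : lam.colLen i + i + (mu.colLen j + j) = N + 2 * (mu.colLen j + i) := by omega
      rw [hsum, pow_add, pow_mul, neg_one_sq, one_pow, mul_one]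
  have hjac := Matrix.det_toBlocks₁₁_of_mul_eq_one (K.submatrix f e) (G.submatrix e f) (by
    rw [Matrix.submatrix_mul_equiv, hinv, Matrix.submatrix_one_equiv])
  have h11 : (K.submatrix f e).toBlocks₁₁ = (Matrix.of fun i j : Fin m =>
      H ((mu.rowLen j : ℤ) - j) ((lam.rowLen i : ℤ) - i)).transpose := by
    ext i j
    change H (f (Sum.inl i)) (e (Sum.inl j)) = H (mu.rowLen i - (i : ℕ)) (lam.rowLen j - (j : ℕ))
    rw [her, hfr]
  have h22 : (G.submatrix e f).toBlocks₂₂ = Matrix.of fun i j : Fin n =>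
      (-1) ^ (lam.colLen i + i : ℕ) * (Matrix.of fun i j : Fin n => (-1) ^ (mu.colLen j + j : ℕ) *
        E ((i : ℤ) + 1 - lam.colLen i) ((j : ℤ) + 1 - mu.colLen j)) i j := by
    ext i j
    exact hG i j
  -- Rows are ordered by the edges of `mu` and columns by those of `lam`; the two orders differ by
  -- the permutation of `sign_edgeEquiv`.
  have hdetK : (K.submatrix f e).det = ∏ j : Fin n, (-1) ^ (lam.colLen j + mu.colLen j) := by
    have : K.submatrix f e = (K.submatrix f f).submatrix id (e.trans f.symm) := by
      ext i j
      simp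
    rw [this, Matrix.det_permute', Matrix.det_submatrix_equiv_self, hdet, mul_one, he, hf,
      YoungDiagram.sign_edgeEquiv h]
    push_cast
    simp
  have hrow := Matrix.det_mul_row (fun j : Fin n => (-1 : R) ^ (mu.colLen j + j : ℕ))
    (Matrix.of fun i j : Fin n => E ((i : ℤ) + 1 - lam.colLen i) ((j : ℤ) + 1 - mu.colLen j))
  simp only [Matrix.of_apply] at hrow
  rw [h11, Matrix.det_transpose, hdetK, h22, Matrix.det_mul_column, hrow, ← mul_assoc,
    ← mul_assoc, ← Finset.prod_mul_distrib, ← Finset.prod_mul_distrib] at hjac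
  rw [hjac, Finset.prod_eq_one, one_mul]
  intro j _
  rw [← pow_add, ← pow_add]
  exact Even.neg_one_pow ⟨lam.colLen j + mu.colLen j + j, by ring⟩

theorem mainTheorem9 {R : Type*} [CommRing R] (lam mu : YoungDiagram) (hmu : mu ≤ lam)
    (a b : ℕ → ℤ) (hab : (SkewRShape.usual lam mu hmu).IsRowFlags a b) (y z : ℤ → R)
    (m n : ℕ) (hm : lam.colLen 0 ≤ m) (hn : lam.rowLen 0 ≤ n) :
    (SkewRShape.usual lam mu hmu).rowFlaggedSchur m a b y z =
      Matrix.det (Matrix.of fun i j : Fin n =>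
        inducedFlaggedE (SkewRShape.usual lam mu hmu) a b
          ((lam.colLen i : ℤ) - (mu.colLen j : ℤ) - (i : ℤ) + (j : ℤ))
          (((i : ℤ) + 1) - (lam.colLen i : ℤ)) y z) := by
  -- The function with parameters `(N, c)` is placed at position `(c, c + N)`, matching the entry of
  -- the inverse it represents.
  rw [SkewRShape.rowFlaggedSchur_usual, det_rows_eq_det_shiftedMinor
    (SkewRShape.stripH_of_lt _ _ _ _ _) (SkewRShape.stripH_self _ _ _ _ _)
    (fun c d => inducedFlaggedE (SkewRShape.usual lam mu hmu) a b (d - c) c y z) ?_ ?_ hmu hm hn]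
  · congr 2
    ext i j
    congr 1
    ring
  · intro c N
    rw [add_sub_cancel_left, inducedFlaggedE, if_pos (Int.natCast_nonneg N), Int.toNat_natCast,
      SkewRShape.flaggedE_induced]
  · intro c d hdc
    rw [inducedFlaggedE, if_neg (by omega)]
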